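/- For a finite generating set $S$ of a group $G$, let $|g|_S$ denote the word length of $g\in G$, that is, the distance from $g$ to $1$ in the Cayley graph of $G$ with respect to $S$. Let $\Delta$ be a finitely presented group and let $N$ be a normal subgroup of $\Delta$ such that the quotient $\Delta/N$ is (Gromov) hyperbolic. Let $$\Delta\times_N\Delta=\{(\delta n,\delta):\delta\in\Delta,\ n\in N\}$$ be the fiber product of $\Delta$ with respect to $N$, a subgroup of $\Delta\times\Delta$. Then $\Delta\times_N\Delta$ is finitely generated, and for every finite generating set $S$ of $\Delta$ and every finite generating set $T$ of $\Delta\times_N\Delta$ there exist constants $C,c>0$ such that $$|(\delta n,\delta)|_T\le C\big(|\delta n|_S+|\delta|_S\big)+c\qquad\text{for all }\delta\in\Delta,\ n\in N.$$ -/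

import Mathlib

/-- The word metric on `G` induced by a generating set `S`: the path metric on the vertices of the
Cayley graph of `G` with respect to `S`, in which `g ≠ h` are joined when `h = g * s` or
`g = h * s` for some `s ∈ S`. It is left invariant. -/
noncomputable def wordDist {G : Type*} [Group G] (S : Set G) (g h : G) : ℕ :=
  (SimpleGraph.mulCayley S).dist g h

/-- The word length `|g| = d(g, 1)` on `G` induced by a generating set `S`. -/
noncomputable def wordLength {G : Type*} [Group G] (S : Set G) (g : G) : ℕ :=
  wordDist S g 1

/-- `S` is a finite generating subset of the group `G`. -/
def IsFiniteGeneratingSet {G : Type*} [Group G] (S : Set G) : Prop :=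
  S.Finite ∧ Subgroup.closure S = ⊤

/-- The Gromov product `(x | y)_w = (d(x, w) + d(y, w) - d(x, y)) / 2` for a distance `d`. -/
noncomputable def gromovProduct {X : Type*} (d : X → X → ℝ) (w x y : X) : ℝ :=
  (d x w + d y w - d x y) / 2

/-- Gromov's definition of a `δ`-hyperbolic metric space:
`(x | z)_w ≥ min ((x | y)_w) ((y | z)_w) - δ` for all points `w`, `x`, `y`, `z`. -/
def IsGromovHyperbolicDist {X : Type*} (d : X → X → ℝ) (δ : ℝ) : Prop :=
  ∀ w x y z : X,
    min (gromovProduct d w x y) (gromovProduct d w y z) - δ ≤ gromovProduct d w x z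

/-- A group is (Gromov) hyperbolic if, for some finite generating set, its Cayley graph is
`δ`-hyperbolic for some `δ ≥ 0`. The condition is imposed on the vertex set with the path metric
of the graph; as every point of the geometric realization is within `1/2` of a vertex, this is the
same as hyperbolicity of the realization, up to the value of `δ`. -/
def IsHyperbolicGroup (G : Type*) [Group G] : Prop :=
  ∃ S : Set G, IsFiniteGeneratingSet S ∧
    ∃ δ : ℝ, 0 ≤ δ ∧ IsGromovHyperbolicDist (fun g h : G => (wordDist S g h : ℝ)) δ

/-- The fiber product `Δ ×_N Δ = {(δ n, δ) : δ ∈ Δ, n ∈ N}`, a subgroup of `Δ × Δ`. -/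
def fiberProduct {Δ : Type*} [Group Δ] (N : Subgroup Δ) [hN : N.Normal] : Subgroup (Δ × Δ) where
  carrier := {p | ∃ δ : Δ, ∃ n ∈ N, p = (δ * n, δ)}
  one_mem' := ⟨1, 1, N.one_mem, by simp only [mul_one]; rfl⟩
  mul_mem' := by
    rintro _ _ ⟨a, m, hm, rfl⟩ ⟨b, n, hn, rfl⟩
    refine ⟨a * b, b⁻¹ * m * b * n, N.mul_mem ?_ hn, ?_⟩
    · simpa using hN.conj_mem m hm b⁻¹
    · simp [mul_assoc]
  inv_mem' := by
    rintro _ ⟨a, m, hm, rfl⟩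
    refine ⟨a⁻¹, a * m⁻¹ * a⁻¹, hN.conj_mem _ (N.inv_mem hm) a, ?_⟩
    simp [mul_assoc]

theorem mem_fiberProduct {Δ : Type*} [Group Δ] (N : Subgroup Δ) [N.Normal]
    (δ : Δ) {n : Δ} (hn : n ∈ N) : (δ * n, δ) ∈ fiberProduct N :=
  ⟨δ, n, hn, rfl⟩

/-!
The distortion of the fiber product is controlled by Dehn's algorithm in the hyperbolic quotient
`Q = Δ ⧸ N`.

Take a finite generating set of `Q` with letters `A` and a section `σ : Q → Δ`, and write `ŵ` for
the product in `Δ` of the `σ`-lifts of a word `w` in `A`. If `n ∈ N` is a product of `m` generators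
of `Δ`, rewriting each of them through `σ` gives a word `w` in `A`, of length linear in `m` and
trivial in `Q`, such that `(n, ŵ)` is a product of `m` elements of a finite subset of the fiber
product. As `(δ * n, δ) = (δ, δ) * (n, ŵ) * (1, ŵ)⁻¹`, it remains to write `(1, ŵ)` as a product of
linearly many elements of a finite subset.

This uses that in a hyperbolic group a word all of whose short subwords are geodesic is trivial in
the group only if it is empty (`IsHyperbolicGroup.exists_locallyGeodesicWord`); that fact is an
immediate induction on the four-point inequality (`IsGromovHyperbolicDist.lt_dist_add`). Hence `w`
can be reduced to the empty word by scanning it once with a stack that is kept locally geodesic: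
when the top `c` of the stack fails to be geodesic, it is replaced by a shorter word `c'` with the
same image in `Q`. Moving the reading position by one letter `a` costs one factor `(σ a, σ a)^{±1}`,
a replacement costs one factor `(1, ĉ * ĉ'⁻¹)`, of which there are finitely many, and a weighted sum
of the lengths of the stack and of the unread input bounds the number of steps linearly
(`inv_diag_mul_mem_pow_of_locallyGeodesicWord`). "A product of at most `m` elements of `X`" is
expressed as membership in the pointwise power `X ^ m` of a set `X` containing `1`.
-/

open scoped Pointwise

/-! ### Words and the word metric -/

/-- `w` is a word in the letters `A`. -/
def IsWordIn {G : Type*} (A : Set G) (w : List G) : Prop :=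
  ∀ a ∈ w, a ∈ A

theorem IsWordIn.append {G : Type*} {A : Set G} {u v : List G} (hu : IsWordIn A u)
    (hv : IsWordIn A v) : IsWordIn A (u ++ v) := fun a ha =>
  (List.mem_append.1 ha).elim (hu a) (hv a)

theorem IsWordIn.of_infix {G : Type*} {A : Set G} {u v : List G} (hv : IsWordIn A v)
    (h : u <:+: v) : IsWordIn A u := fun a ha => hv a (h.subset ha)

theorem wordDist_mul_prod_le {G : Type*} [Group G] {S : Set G} {w : List G}
    (hw : IsWordIn (S ∪ S⁻¹) w) (g : G) :
    (SimpleGraph.mulCayley S).Reachable g (g * w.prod) ∧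
      wordDist S g (g * w.prod) ≤ w.length := by
  induction w generalizing g with
  | nil => simp [wordDist]
  | cons a w ih =>
    obtain ⟨hr, hd⟩ := ih (fun b hb => hw b (List.mem_cons_of_mem a hb)) (g * a)
    rw [List.prod_cons, ← mul_assoc, List.length_cons]
    by_cases h : g = g * a
    · rw [← h] at hr hd ⊢
      exact ⟨hr, hd.trans (Nat.le_succ _)⟩
    · have hadj : (SimpleGraph.mulCayley S).Adj g (g * a) := by
        rw [SimpleGraph.mulCayley_adj']
        refine ⟨h, ?_⟩
        rcases hw a List.mem_cons_self with ha | ha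
        · exact ⟨a, ha, Or.inl rfl⟩
        · exact ⟨a⁻¹, ha, Or.inr (by simp)⟩
      refine ⟨hadj.reachable.trans hr, ?_⟩
      obtain ⟨p, hp⟩ := hr.exists_walk_length_eq_dist
      refine (SimpleGraph.dist_le (SimpleGraph.Walk.cons hadj p)).trans ?_
      rw [SimpleGraph.Walk.length_cons, hp]
      exact Nat.succ_le_succ hd

theorem exists_word_of_walk {G : Type*} [Group G] {S : Set G} {g h : G}
    (p : (SimpleGraph.mulCayley S).Walk g h) :
    ∃ w : List G, IsWordIn (S ∪ S⁻¹) w ∧ g * w.prod = h ∧ w.length = p.length := by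
  induction p with
  | nil => exact ⟨[], by simp [IsWordIn], by simp, rfl⟩
  | @cons a b c hab p ih =>
    obtain ⟨w, hw, hprod, hlen⟩ := ih
    refine ⟨(a⁻¹ * b) :: w, ?_, by simp [mul_assoc, hprod], by simp [hlen]⟩
    rw [SimpleGraph.mulCayley_adj'] at hab
    obtain ⟨-, s, hs, hab | hab⟩ := hab
    · intro x hx
      rcases List.mem_cons.1 hx with rfl | hx
      · left; simpa [← hab] using hs
      · exact hw x hx
    · intro x hx
      rcases List.mem_cons.1 hx with rfl | hx
      · right; simpa [hab] using hs
      · exact hw x hx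

theorem mulCayley_connected {G : Type*} [Group G] {S : Set G} (hS : Subgroup.closure S = ⊤) :
    (SimpleGraph.mulCayley S).Connected := by
  refine (SimpleGraph.connected_iff _).2 ⟨fun g h => ?_, ⟨1⟩⟩
  have hmem : g⁻¹ * h ∈ Subgroup.closure S := hS ▸ Subgroup.mem_top _
  rw [← Subgroup.mem_toSubmonoid, Subgroup.closure_toSubmonoid] at hmem
  obtain ⟨w, hw, hprod⟩ := Submonoid.exists_list_of_mem_closure hmem
  have := (wordDist_mul_prod_le (S := S) (w := w) hw g).1
  rwa [hprod, mul_inv_cancel_left] at this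

theorem exists_word_length_eq_wordDist {G : Type*} [Group G] {S : Set G}
    (hS : Subgroup.closure S = ⊤) (g h : G) :
    ∃ w : List G, IsWordIn (S ∪ S⁻¹) w ∧ g * w.prod = h ∧ w.length = wordDist S g h := by
  obtain ⟨p, hp⟩ := (mulCayley_connected hS).exists_walk_length_eq_dist g h
  obtain ⟨w, hw, hprod, hlen⟩ := exists_word_of_walk p
  exact ⟨w, hw, hprod, hlen.trans hp⟩

theorem exists_word_length_eq_wordLength {G : Type*} [Group G] {S : Set G}
    (hS : Subgroup.closure S = ⊤) (g : G) :
    ∃ w : List G, IsWordIn (S ∪ S⁻¹) w ∧ w.prod = g ∧ w.length = wordLength S g := by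
  obtain ⟨w, hw, hprod, hlen⟩ := exists_word_length_eq_wordDist hS 1 g
  refine ⟨w, hw, by simpa using hprod, hlen.trans ?_⟩
  exact SimpleGraph.dist_comm

theorem wordLength_mul_le {G : Type*} [Group G] {S : Set G}
    (hS : Subgroup.closure S = ⊤) (g h : G) :
    wordLength S (g * h) ≤ wordLength S g + wordLength S h := by
  obtain ⟨u, hu, rfl, hul⟩ := exists_word_length_eq_wordLength hS g
  obtain ⟨v, hv, rfl, hvl⟩ := exists_word_length_eq_wordLength hS h
  have h2 := (wordDist_mul_prod_le (hu.append hv) 1).2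
  rw [one_mul, List.prod_append, List.length_append, hul, hvl] at h2
  rwa [wordLength, wordDist, SimpleGraph.dist_comm]

theorem exists_wordLength_le_of_mem_pow {G : Type*} [Group G] {T X : Set G}
    (hT : Subgroup.closure T = ⊤) (hX : X.Finite) :
    ∃ M : ℕ, ∀ m : ℕ, ∀ g ∈ X ^ m, wordLength T g ≤ M * m := by
  obtain ⟨M, hM⟩ := (hX.image (wordLength T)).bddAbove
  refine ⟨M, fun m => ?_⟩
  induction m with
  | zero => simp [wordLength, wordDist]
  | succ m ih =>
    rw [pow_succ]
    rintro _ ⟨g, hg, x, hx, rfl⟩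
    have h1 := ih g hg
    have h2 : wordLength T x ≤ M := hM (Set.mem_image_of_mem _ hx)
    have h3 := wordLength_mul_le hT g x
    dsimp only
    rw [mul_add, mul_one]
    omega

theorem IsWordIn.map_prod_mem_pow {G P : Type*} [Monoid P] {A : Set G} {X : Set P} {f : G → P}
    (hf : ∀ a ∈ A, f a ∈ X) {w : List G} (hw : IsWordIn A w) : (w.map f).prod ∈ X ^ w.length := by
  induction w with
  | nil => simp
  | cons a w ih =>
    rw [List.map_cons, List.prod_cons, List.length_cons, pow_succ']
    exact Set.mul_mem_mul (hf a (hw a List.mem_cons_self))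
      (ih fun b hb => hw b (List.mem_cons_of_mem a hb))

/-! ### Local geodesics in hyperbolic groups -/

/-- `w` is a word in the letters `A`, and no shorter word in `A` has the same product. -/
def IsGeodesicWord {G : Type*} [Monoid G] (A : Set G) (w : List G) : Prop :=
  IsWordIn A w ∧ ∀ w', IsWordIn A w' → w'.prod = w.prod → w.length ≤ w'.length

/-- `w` is a word in the letters `A` whose contiguous subwords of length at most `k` are all
geodesic. -/
def IsLocallyGeodesicWord {G : Type*} [Monoid G] (A : Set G) (k : ℕ) (w : List G) : Prop :=
  IsWordIn A w ∧ ∀ c, c <:+: w → c.length ≤ k → IsGeodesicWord A c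

theorem IsGeodesicWord.wordDist_eq {G : Type*} [Group G] {S : Set G}
    (hS : Subgroup.closure S = ⊤) {c : List G} (hc : IsGeodesicWord (S ∪ S⁻¹) c) (g : G) :
    wordDist S g (g * c.prod) = c.length := by
  refine le_antisymm (wordDist_mul_prod_le hc.1 g).2 ?_
  obtain ⟨w, hw, hprod, hlen⟩ := exists_word_length_eq_wordDist hS g (g * c.prod)
  rw [← hlen]
  exact hc.2 w hw (mul_left_cancel hprod)

/-- The hyperbolicity inequality with base point `p`, multiplied out into distances. -/
theorem IsGromovHyperbolicDist.four_point {X : Type*} {d : X → X → ℝ} {δ : ℝ}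
    (h : IsGromovHyperbolicDist d δ) (hsymm : ∀ x y, d x y = d y x) (p x q y : X) :
    d p q + d x y ≤ max (d p x + d q y) (d p y + d x q) + 2 * δ := by
  have := h p x q y
  simp only [gromovProduct] at this
  rcases le_total (d p x + d q y) (d p y + d x q) with h1 | h1 <;>
    rcases min_choice ((d x p + d q p - d x q) / 2) ((d q p + d y p - d q y) / 2) with h2 | h2 <;>
    rw [h2] at this <;>
    simp only [h1, max_eq_left, max_eq_right] <;>
    linarith [hsymm p q, hsymm p x, hsymm p y, min_le_left
      ((d x p + d q p - d x q) / 2) ((d q p + d y p - d q y) / 2)]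

/-- Along a sequence whose stretches of length at most `2 * L` are isometrically embedded in a
`δ`-hyperbolic space with `2 * δ < L`, each `L` steps increase the distance from the start. -/
theorem IsGromovHyperbolicDist.lt_dist_add {X : Type*} {d : X → X → ℝ} {δ : ℝ}
    (h : IsGromovHyperbolicDist d δ) (hsymm : ∀ x y, d x y = d y x) {L : ℕ}
    (hδ : 0 ≤ δ) (hL : 2 * δ < L) {x : ℕ → X} {n : ℕ}
    (hx : ∀ i j, j ≤ 2 * L → i + j ≤ n → d (x i) (x (i + j)) = j) (i : ℕ) (hi : i + L ≤ n) :
    d (x 0) (x i) < d (x 0) (x (i + L)) := by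
  have hL0 : (0 : ℝ) < L := by linarith
  induction i using Nat.strong_induction_on with
  | _ i ih =>
    rcases lt_or_ge i L with hiL | hiL
    · have h1 := hx 0 i (by omega) (by omega)
      have h2 := hx 0 (i + L) (by omega) (by omega)
      rw [zero_add] at h1 h2
      rw [h1, h2]
      push_cast
      linarith
    -- The four-point inequality for the start and the positions `j`, `j + L`, `j + 2 * L`: by the
    -- induction hypothesis the first of the two sums in its maximum is too small to attain it.
    · obtain ⟨j, rfl⟩ := Nat.exists_eq_add_of_le' hiL
      have hj := ih j (by have : 0 < L := by exact_mod_cast hL0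
                          omega) (by omega)
      have h1 := hx j L (by omega) (by omega)
      have h2 := hx (j + L) L (by omega) (by omega)
      have h3 := hx j (L + L) (by omega) (by omega)
      rw [← add_assoc] at h3
      push_cast at h3
      have h4 := h.four_point hsymm (x 0) (x j) (x (j + L)) (x (j + L + L))
      rcases max_choice (d (x 0) (x j) + d (x (j + L)) (x (j + L + L)))
        (d (x 0) (x (j + L + L)) + d (x j) (x (j + L))) with h5 | h5 <;> rw [h5] at h4 <;> linarith

/-- In a hyperbolic group, a word whose subwords of length at most `k` are geodesic, for a suitable
`k`, represents the identity only if it is empty. -/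
theorem IsHyperbolicGroup.exists_locallyGeodesicWord {G : Type*} [Group G]
    (hG : IsHyperbolicGroup G) :
    ∃ S : Set G, IsFiniteGeneratingSet S ∧ ∃ k : ℕ, ∀ w : List G,
      IsLocallyGeodesicWord (S ∪ S⁻¹) k w → w.prod = 1 → w = [] := by
  obtain ⟨S, hS, δ, hδ, hyp⟩ := hG
  obtain ⟨L, hL⟩ := exists_nat_gt (2 * δ)
  refine ⟨S, hS, 2 * L, fun w hw hw1 => ?_⟩
  have hsymm : ∀ g h : G, (wordDist S g h : ℝ) = wordDist S h g := fun g h => by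
    rw [wordDist, SimpleGraph.dist_comm, wordDist]
  have hx : ∀ i j, j ≤ 2 * L → i + j ≤ w.length →
      (wordDist S (w.take i).prod (w.take (i + j)).prod : ℝ) = j := by
    intro i j hj hij
    have hlen : ((w.drop i).take j).length = j := by
      rw [List.length_take, List.length_drop]; omega
    have hc := hw.2 ((w.drop i).take j)
      ((List.take_prefix _ _).isInfix.trans (List.drop_suffix _ _).isInfix) (hlen.trans_le hj)
    have := hc.wordDist_eq hS.2 (w.take i).prod
    rw [List.take_add, List.prod_append, this, hlen]
  have hlast : wordDist S (w.take 0).prod (w.take w.length).prod = 0 := by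
    simp [hw1, wordDist]
  rcases le_or_gt L w.length with hLw | hLw
  · have := hyp.lt_dist_add hsymm hδ hL (x := fun i => (w.take i).prod) hx (w.length - L)
      (by omega)
    rw [Nat.sub_add_cancel hLw] at this
    simp only [hlast, Nat.cast_zero] at this
    exact absurd this (not_lt.2 (Nat.cast_nonneg _))
  · have := hx 0 w.length (by omega) (by omega)
    rw [zero_add, hlast, Nat.cast_inj] at this
    exact List.length_eq_zero_iff.1 this.symm

/-! ### Dehn's algorithm -/

/-- Pushing a letter onto a locally geodesic word either preserves local geodesicity or creates a
suffix of length at most `k` that can be shortened. -/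
theorem IsLocallyGeodesicWord.concat_or_shorten {G : Type*} [Monoid G] {A : Set G} {k : ℕ}
    {u : List G} (hu : IsLocallyGeodesicWord A k u) {a : G} (ha : a ∈ A) :
    IsLocallyGeodesicWord A k (u ++ [a]) ∨
      ∃ u' c c' : List G, u ++ [a] = u' ++ c ∧ IsLocallyGeodesicWord A k u' ∧ IsWordIn A c ∧
        IsWordIn A c' ∧ c.length ≤ k ∧ c'.length < c.length ∧ c'.prod = c.prod := by
  have hw : IsWordIn A (u ++ [a]) := hu.1.append (by simpa [IsWordIn] using ha)
  by_contra! hcon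
  obtain ⟨h1, h2⟩ := hcon
  refine h1 ⟨hw, fun c hc hck => ⟨hw.of_infix hc, fun c' hc' hprod => ?_⟩⟩
  by_contra! hlt
  rcases List.infix_concat_iff.1 hc with hsuf | hinf
  · obtain ⟨u', hu'⟩ := hsuf
    refine h2 u' c c' hu'.symm ?_ (hw.of_infix hc) hc' hck hlt hprod
    have hpre : u' <+: u := by
      have hc0 : c ≠ [] := by rintro rfl; simp at hlt
      rw [← List.dropLast_concat (l₁ := u) (b := a), ← hu', List.dropLast_append_of_ne_nil hc0]
      exact List.prefix_append _ _
    exact ⟨hu.1.of_infix hpre.isInfix, fun d hd => hu.2 d (hd.trans hpre.isInfix)⟩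
  · exact absurd ((hu.2 c hinf hck).2 c' hc' hprod) (not_le.2 hlt)

/-- Dehn's algorithm run with a stack: `u` is the stack, `v` the input still to be read. Pushing the
next letter, or popping a suffix `c` that can be shortened and returning its replacement `c'` to
the input, changes the element below by at most `k + 2` factors from `X`, and decreases
`k * (u.length + v.length) + v.length`. -/
theorem inv_diag_mul_mem_pow_of_locallyGeodesicWord {Δ Q : Type*} [Group Δ] [Group Q] {A : Set Q}
    {k : ℕ} (hA : ∀ w : List Q, IsLocallyGeodesicWord A k w → w.prod = 1 → w = [])
    (σ : Q → Δ) {X : Set (Δ × Δ)} (hX1 : (1 : Δ × Δ) ∈ X)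
    (hXd : ∀ a ∈ A, (σ a, σ a) ∈ X) (hXd' : ∀ a ∈ A, (σ a, σ a)⁻¹ ∈ X)
    (hXr : ∀ c c' : List Q, IsWordIn A c → IsWordIn A c' → c.length ≤ k → c'.length ≤ k →
      c'.prod = c.prod → (1, (c.map σ).prod * (c'.map σ).prod⁻¹) ∈ X)
    (m : ℕ) (u v : List Q) (hu : IsLocallyGeodesicWord A k u) (hv : IsWordIn A v)
    (huv : (u ++ v).prod = 1) (hm : k * (u.length + v.length) + v.length ≤ m) :
    (((u.map σ).prod, (u.map σ).prod)⁻¹ * (1, ((u ++ v).map σ).prod) : Δ × Δ) ∈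
      X ^ ((k + 2) * m) := by
  induction m using Nat.strong_induction_on generalizing u v with
  | _ m ih =>
    rcases v with _ | ⟨a, v⟩
    · obtain rfl : u = [] := hA u hu (by simpa using huv)
      simpa [← Prod.one_eq_mk] using Set.one_mem_pow hX1
    · have ha : a ∈ A := hv a List.mem_cons_self
      have hv' : IsWordIn A v := fun b hb => hv b (List.mem_cons_of_mem a hb)
      rw [List.length_cons] at hm
      have hm1 : m - 1 + 1 = m := Nat.sub_add_cancel (by omega)
      rcases hu.concat_or_shorten ha with h | ⟨u', c, c', huc, hu', hc, hc', hck, hlt, hprod⟩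
      · have key := ih (m - 1) (by omega) (u ++ [a]) v h hv' (by simpa using huv) (by
          rw [List.length_append, List.length_singleton, add_assoc, add_comm 1]
          omega)
        have := Set.mul_mem_mul (hXd a ha) key
        rw [← pow_succ'] at this
        convert Set.pow_subset_pow_right hX1 (n := (k + 2) * m) ?_ this using 1
        · ext <;> simp [mul_assoc]
        · rw [← hm1, mul_add]
          simp only [Nat.add_sub_cancel]
          omega
      -- `D(u)⁻¹ * (1, uav) = D(a) * D(c)⁻¹ * (1, c * c'⁻¹) * D(u')⁻¹ * (1, u'c'v)`, where
      -- `D(x) = (x, x)` and words stand for their images under `σ`.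
      · have hlen : u.length + 1 = u'.length + c.length := by
          simpa using congrArg List.length huc
        have hmap := congrArg (fun l => (l.map σ).prod) huc
        simp only [List.map_append, List.prod_append, List.map_cons, List.map_nil,
          List.prod_singleton] at hmap
        have hmapu : (u.map σ).prod = (u'.map σ).prod * (c.map σ).prod * (σ a)⁻¹ :=
          eq_mul_inv_of_mul_eq hmap
        have key := ih (m - 1) (by omega) u' (c' ++ v) hu' (hc'.append hv') (by
          rw [← huv, List.append_cons u a v, huc]
          simp [hprod]) (by
          rw [List.length_append]
          have h1 : k * (u'.length + (c'.length + v.length)) + k ≤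
              k * (u.length + (v.length + 1)) := by
            rw [← mul_add_one]
            exact Nat.mul_le_mul_left k (by omega)
          omega)
        have hcinv : (((c.map σ).prod, (c.map σ).prod)⁻¹ : Δ × Δ) ∈ X ^ k := by
          have h1 : (c.reverse.map fun b => (σ b, σ b)⁻¹).prod =
              (((c.map σ).prod, (c.map σ).prod)⁻¹ : Δ × Δ) := by
            clear * -
            induction c with
            | nil => ext <;> simp
            | cons b c ih =>
              simp only [List.reverse_cons, List.map_append, List.prod_append, ih]
              ext <;> simp
          rw [← h1]
          refine Set.pow_subset_pow_right hX1 ?_ (IsWordIn.map_prod_mem_pow hXd'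
            (w := c.reverse) fun b hb => hc b (List.mem_reverse.1 hb))
          rwa [List.length_reverse]
        have := Set.mul_mem_mul (Set.mul_mem_mul (Set.mul_mem_mul (hXd a ha) hcinv)
          (hXr c c' hc hc' hck (hlt.le.trans hck) hprod)) key
        rw [← pow_succ', ← pow_succ, ← pow_add] at this
        convert Set.pow_subset_pow_right hX1 (n := (k + 2) * m) ?_ this using 1
        · ext <;> simp [mul_assoc, hmapu]
        · conv_rhs => rw [← hm1, mul_add]
          omega

/-! ### Linear distortion of the fiber product -/

theorem mem_fiberProduct_iff {Δ : Type*} [Group Δ] {N : Subgroup Δ} [N.Normal] {p : Δ × Δ} :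
    p ∈ fiberProduct N ↔ (p.1 : Δ ⧸ N) = p.2 := by
  rw [eq_comm, QuotientGroup.eq]
  constructor
  · rintro ⟨δ, n, hn, rfl⟩
    simpa using hn
  · intro h
    exact ⟨p.2, p.2⁻¹ * p.1, h, by simp⟩

theorem Set.Finite.pow_nat {G : Type*} [Monoid G] {B : Set G} (hB : B.Finite) (k : ℕ) :
    (B ^ k).Finite := by
  induction k with
  | zero => simp
  | succ k ih => rw [pow_succ]; exact ih.mul hB

theorem prod_map_flatMap {Q Δ R : Type*} [Monoid R] (ω : Δ → List Q) (f : Q → R)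
    (l : List Δ) : ((l.flatMap ω).map f).prod = (l.map fun s => ((ω s).map f).prod).prod := by
  induction l with
  | nil => simp
  | cons s l ih => simp [ih]

/-- Each element `(δ * n, δ)` of the fiber product is a product of elements of a fixed finite set,
their number being linear in the word lengths of `δ * n` and `δ`. -/
theorem exists_finite_subset_fiberProduct {Δ : Type*} [Group Δ] (N : Subgroup Δ) [N.Normal]
    (hyp : IsHyperbolicGroup (Δ ⧸ N)) {S : Set Δ} (hS : IsFiniteGeneratingSet S) :
    ∃ X : Set (fiberProduct N), X.Finite ∧ ∃ C : ℕ, ∀ (δ n : Δ) (hn : n ∈ N),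
      ⟨(δ * n, δ), mem_fiberProduct N δ hn⟩ ∈
        X ^ (C * (wordLength S (δ * n) + wordLength S δ)) := by
  obtain ⟨S', hS', k, hk⟩ := hyp.exists_locallyGeodesicWord
  set A := S' ∪ S'⁻¹ with hAdef
  have hAfin : A.Finite := hS'.1.union hS'.1.inv
  set A₀ := S ∪ S⁻¹ with hA₀def
  have hA₀fin : A₀.Finite := hS.1.union hS.1.inv
  obtain ⟨σ, hσ⟩ : ∃ σ : Δ ⧸ N → Δ, ∀ q, (σ q : Δ ⧸ N) = q :=
    ⟨Quotient.out, QuotientGroup.out_eq'⟩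
  have hσprod : ∀ w : List (Δ ⧸ N), ((w.map σ).prod : Δ ⧸ N) = w.prod := fun w => by
    induction w with
    | nil => simp
    | cons a w ih => simp [hσ, ih]
  choose ω hωA hωprod _ using fun s : Δ =>
    exists_word_length_eq_wordLength hS'.2 (s : Δ ⧸ N)
  obtain ⟨M, hM⟩ := (hA₀fin.image fun s => (ω s).length).bddAbove
  set B : Set Δ := insert 1 (σ '' A) with hBdef
  have hBfin : B.Finite := (hAfin.image σ).insert 1
  have hBword : ∀ c : List (Δ ⧸ N), IsWordIn A c → c.length ≤ k → (c.map σ).prod ∈ B ^ k :=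
    fun c hc hck => Set.pow_subset_pow_right (Set.mem_insert 1 _) hck
      (hc.map_prod_mem_pow fun a ha => Set.mem_insert_of_mem 1 (Set.mem_image_of_mem σ ha))
  -- Besides `1`: the diagonal generators, the relators of length at most `2 * k` used by Dehn's
  -- algorithm, and the pairs of a generator of `Δ` with its rewriting in `A`.
  set Z : Set (Δ × Δ) := insert 1 ((fun b => (b, b)) '' (σ '' A ∪ A₀) ∪
    (fun r => (1, r)) '' (B ^ k * (B ^ k)⁻¹ ∩ (N : Set Δ)) ∪
    (fun s => (s, ((ω s).map σ).prod)) '' A₀) with hZdef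
  have hZfin : Z.Finite := by
    refine Set.Finite.insert 1 (((((hAfin.image σ).union hA₀fin).image _).union ?_).union
      (hA₀fin.image _))
    exact (((hBfin.pow_nat k).mul (hBfin.pow_nat k).inv).inter_of_left _).image _
  have hZsub : Z ⊆ fiberProduct N := by
    rintro _ (rfl | ((⟨b, -, rfl⟩ | ⟨r, hr, rfl⟩) | ⟨s, -, rfl⟩))
    · exact one_mem _
    · exact mem_fiberProduct_iff.2 rfl
    · refine mem_fiberProduct_iff.2 ?_
      exact ((QuotientGroup.eq_one_iff r).2 hr.2).symm
    · refine mem_fiberProduct_iff.2 ?_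
      exact ((hσprod _).trans (hωprod s)).symm
  set X : Set (Δ × Δ) := Z ∪ Z⁻¹ with hXdef
  have hXsub : X ⊆ fiberProduct N := by
    rintro p (hp | hp)
    · exact hZsub hp
    · exact (inv_mem_iff (H := fiberProduct N)).1 (hZsub hp)
  have hXinv : X⁻¹ = X := by rw [hXdef, Set.union_inv, inv_inv, Set.union_comm]
  have hX1 : (1 : Δ × Δ) ∈ X := Or.inl (Set.mem_insert 1 _)
  have hXd : ∀ b ∈ σ '' A ∪ A₀, (b, b) ∈ X := fun b hb =>
    Or.inl (Or.inr (Or.inl (Or.inl ⟨b, hb, rfl⟩)))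
  have hDehn : ∀ w : List (Δ ⧸ N), IsWordIn A w → w.prod = 1 →
      ((1, (w.map σ).prod) : Δ × Δ) ∈ X ^ ((k + 2) * ((k + 1) * w.length)) := by
    intro w hw hw1
    have := inv_diag_mul_mem_pow_of_locallyGeodesicWord hk σ hX1
      (fun a ha => hXd _ (Or.inl ⟨a, ha, rfl⟩))
      (fun a ha => by
        rw [← hXinv, Set.inv_mem_inv]
        exact hXd _ (Or.inl ⟨a, ha, rfl⟩))
      (fun c c' hc hc' hck hck' hprod => by
        refine Or.inl (Or.inr (Or.inl (Or.inr ⟨_, ⟨?_, ?_⟩, rfl⟩)))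
        · exact Set.mul_mem_mul (hBword c hc hck) (Set.inv_mem_inv.2 (hBword c' hc' hck'))
        · refine (QuotientGroup.eq_one_iff _).1 ?_
          rw [QuotientGroup.mk_mul, QuotientGroup.mk_inv, hσprod, hσprod, hprod, mul_inv_cancel])
      ((k + 1) * w.length) [] w ⟨by simp [IsWordIn], fun c hc _ => by
        obtain rfl := List.infix_nil.1 hc
        exact ⟨by simp [IsWordIn], by simp⟩⟩ hw (by simpa using hw1) (by
          rw [List.length_nil, zero_add, add_mul, one_mul])
    simpa using this
  set C := 2 + (k + 2) * ((k + 1) * M) with hCdef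
  have hpow : ∀ δ n : Δ, n ∈ N →
      ((δ * n, δ) : Δ × Δ) ∈ X ^ (C * (wordLength S (δ * n) + wordLength S δ)) := by
    intro δ n hn
    obtain ⟨e, he, heprod, helen⟩ := exists_word_length_eq_wordLength hS.2 δ
    -- `l` labels a geodesic from `δ` to `δ * n`, so it spells `n` and the triangle inequality
    -- through `1` bounds its length.
    obtain ⟨l, hl, hlprod, hllen⟩ := exists_word_length_eq_wordDist hS.2 δ (δ * n)
    replace hlprod : l.prod = n := mul_left_cancel hlprod
    set t := wordLength S (δ * n) + wordLength S δ with htdef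
    have hlt : l.length ≤ t := by
      rw [hllen, htdef, add_comm, wordLength, wordLength, wordDist, wordDist, wordDist,
        SimpleGraph.dist_comm (u := δ * n)]
      exact (mulCayley_connected hS.2).dist_triangle
    set w := l.flatMap ω with hwdef
    have hwA : IsWordIn A w := fun a ha => by
      obtain ⟨s, -, hs⟩ := List.mem_flatMap.1 ha
      exact hωA s a hs
    have hwlen : w.length ≤ M * t := by
      refine le_trans ?_ (Nat.mul_le_mul_left M hlt)
      rw [hwdef]
      clear * - hl hM
      induction l with
      | nil => simp
      | cons s l ih =>
        have h1 := ih fun b hb => hl b (List.mem_cons_of_mem s hb)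
        have h2 : (ω s).length ≤ M := hM (Set.mem_image_of_mem _ (hl s List.mem_cons_self))
        rw [List.flatMap_cons, List.length_append, List.length_cons, mul_add, mul_one]
        omega
    have hwprod : w.prod = 1 := by
      have h1 : w.prod = ((l.prod : Δ) : Δ ⧸ N) := by
        have := prod_map_flatMap ω (fun q => q) l
        rw [List.map_id'] at this
        rw [hwdef, this]
        simp only [List.map_id', hωprod]
        exact (map_list_prod (QuotientGroup.mk' N) l).symm
      rw [h1, hlprod]
      exact (QuotientGroup.eq_one_iff n).2 hn
    have hdiag : ((δ, δ) : Δ × Δ) ∈ X ^ t := by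
      have h1 := he.map_prod_mem_pow (X := X) (f := fun b => (b, b))
        fun b hb => hXd b (Or.inr hb)
      have h2 : (e.map fun b => (b, b)).prod = ((δ, δ) : Δ × Δ) := by
        rw [← heprod]
        exact (map_list_prod ((MonoidHom.id Δ).prod (MonoidHom.id Δ)) e).symm
      rw [h2] at h1
      exact Set.pow_subset_pow_right hX1 (by omega) h1
    have hlift : ((n, (w.map σ).prod) : Δ × Δ) ∈ X ^ t := by
      have h1 := hl.map_prod_mem_pow (X := X) (f := fun s => (s, ((ω s).map σ).prod))
        fun s hs => Or.inl (Or.inr (Or.inr ⟨s, hs, rfl⟩))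
      have h2 : (l.map fun s => (s, ((ω s).map σ).prod)).prod = ((n, (w.map σ).prod) : Δ × Δ) := by
        rw [hwdef, prod_map_flatMap, ← hlprod]
        clear * -
        induction l with
        | nil => ext <;> simp
        | cons s l ih => simp [ih]
      rw [h2] at h1
      exact Set.pow_subset_pow_right hX1 hlt h1
    have hfill : ((1, (w.map σ).prod)⁻¹ : Δ × Δ) ∈ X ^ ((k + 2) * ((k + 1) * (M * t))) := by
      rw [← hXinv, inv_pow, Set.inv_mem_inv]
      refine Set.pow_subset_pow_right hX1 ?_ (hDehn w hwA hwprod)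
      gcongr
    have := Set.mul_mem_mul (Set.mul_mem_mul hdiag hlift) hfill
    rw [← pow_add, ← pow_add] at this
    have h1 : ((δ, δ) * (n, (w.map σ).prod) * (1, (w.map σ).prod)⁻¹ : Δ × Δ) = (δ * n, δ) := by
      ext <;> simp
    have h2 : t + t + (k + 2) * ((k + 1) * (M * t)) = C * t := by
      rw [hCdef]
      ring
    rwa [h1, h2] at this
  refine ⟨(fiberProduct N).subtype ⁻¹' X,
    (hZfin.union hZfin.inv).preimage Subtype.val_injective.injOn, C, fun δ n hn => ?_⟩
  have h1 := hpow δ n hn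
  have himage : (fiberProduct N).subtype '' ((fiberProduct N).subtype ⁻¹' X) = X := by
    refine Set.image_preimage_eq_of_subset fun p hp => ?_
    exact ⟨⟨p, hXsub hp⟩, rfl⟩
  rw [← himage, ← Set.image_pow] at h1
  obtain ⟨p, hp, hpeq⟩ := h1
  rwa [show p = ⟨(δ * n, δ), mem_fiberProduct N δ hn⟩ from Subtype.ext hpeq] at hp

theorem Group.IsFinitelyPresented.exists_isFiniteGeneratingSet (G : Type*) [Group G]
    [h : Group.IsFinitelyPresented G] : ∃ S : Set G, IsFiniteGeneratingSet S := by
  obtain ⟨n, φ, hφ, -⟩ := h.out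
  refine ⟨φ '' Set.range FreeGroup.of, (Set.finite_range _).image φ, ?_⟩
  rw [← MonoidHom.map_closure, FreeGroup.closure_range_of, Subgroup.map_top_of_surjective φ hφ]

theorem proposition2p3 {Δ : Type*} [Group Δ] [Group.IsFinitelyPresented Δ]
    (N : Subgroup Δ) [N.Normal] (hyp : IsHyperbolicGroup (Δ ⧸ N)) :
    Group.FG (fiberProduct N) ∧
    ∀ (S : Set Δ) (T : Set (fiberProduct N)),
      IsFiniteGeneratingSet S → IsFiniteGeneratingSet T →
      ∃ C c : ℝ, 0 < C ∧ 0 < c ∧ ∀ (δ n : Δ) (hn : n ∈ N),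
        (wordLength T ⟨(δ * n, δ), mem_fiberProduct N δ hn⟩ : ℝ) ≤
          C * ((wordLength S (δ * n) : ℝ) + (wordLength S δ : ℝ)) + c := by
  constructor
  · obtain ⟨S, hS⟩ := Group.IsFinitelyPresented.exists_isFiniteGeneratingSet Δ
    obtain ⟨X, hX, C, hC⟩ := exists_finite_subset_fiberProduct N hyp hS
    refine Group.fg_iff.2 ⟨X, (Subgroup.eq_top_iff' _).2 ?_, hX⟩
    rintro ⟨_, δ, n, hn, rfl⟩
    have hpow : ∀ m : ℕ, X ^ m ⊆ Subgroup.closure X := fun m => by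
      induction m with
      | zero => simp
      | succ m ih =>
        rw [pow_succ]
        rintro _ ⟨g, hg, x, hx, rfl⟩
        exact mul_mem (ih hg) (Subgroup.subset_closure hx)
    exact hpow _ (hC δ n hn)
  · intro S T hS hT
    obtain ⟨X, hX, C, hC⟩ := exists_finite_subset_fiberProduct N hyp hS
    obtain ⟨M, hM⟩ := exists_wordLength_le_of_mem_pow hT.2 hX
    refine ⟨M * C + 1, 1, by positivity, one_pos, fun δ n hn => ?_⟩
    have h1 := hM _ _ (hC δ n hn)
    have h2 : (wordLength T ⟨(δ * n, δ), mem_fiberProduct N δ hn⟩ : ℝ) ≤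
        M * (C * ((wordLength S (δ * n) : ℝ) + (wordLength S δ : ℝ))) := by exact_mod_cast h1
    refine h2.trans ?_
    have h3 : (0 : ℝ) ≤ (wordLength S (δ * n) : ℝ) + (wordLength S δ : ℝ) := by positivity
    linarith
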